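/- Let $G$ be a $(3,6)$-fullerene, that is, a finite cubic polyhedral graph (a 3-regular, 3-connected simple graph embedded in the sphere) each of whose faces is a hexagon or a triangle. Then the faces of $G$ have a regular 4-coloring: each face can be given one of four colors such that any two faces sharing an edge have different colors (so the three faces at each vertex have three different colors), and such that for every edge $uv$ of $G$ the face at $v$ that is not incident with the edge $uv$ has the fourth color, different from the colors of the three faces at $u$. -/

import Mathlib

namespace Fullerene

variable {V : Type*}

/-- A graph is 3-connected: it has at least four vertices, and deleting any set of at most two
vertices leaves a connected graph (deleting the empty set: the graph itself is connected). -/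
def IsThreeConnected (G : SimpleGraph V) : Prop :=
  4 ≤ Nat.card V ∧ ∀ s : Set V, s.Finite → s.ncard ≤ 2 → (G.induce sᶜ).Connected

/-- A rotation system of a graph, i.e. a combinatorial embedding of it in an oriented closed
surface: a permutation of the darts (directed edges) which, at each vertex `v`, permutes the darts
that start at `v` in one cycle. `rot d` is the next dart after `d` around their common starting
vertex. -/
structure RotationSystem (G : SimpleGraph V) where
  rot : Equiv.Perm G.Dart
  sameCycle_iff : ∀ d e : G.Dart, rot.SameCycle d e ↔ d.fst = e.fst

namespace RotationSystem

variable {G : SimpleGraph V} (R : RotationSystem G)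

/-- The face permutation: having walked along `d`, turn into the next dart (in the rotation at the
end of `d`) after the reversal of `d`. Its cycles are the boundary walks of the faces. -/
def facePerm : Equiv.Perm G.Dart :=
  (SimpleGraph.Dart.symm_involutive (G := G)).toPerm.trans R.rot

/-- The faces of the embedding: the cycles of the face permutation. -/
def Face : Type _ := Quotient (Equiv.Perm.SameCycle.setoid R.facePerm)

/-- The face whose boundary walk runs through the dart `d`. The two faces on the two sides of the
edge of `d` are `R.face d` and `R.face d.symm`. The faces at the corners of the starting vertex of
`d` are `R.face d`, `R.face (R.rot d)`, `R.face (R.rot (R.rot d))`, and so on; moreover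
`R.face (R.rot d) = R.face d.symm`. -/
def face (d : G.Dart) : R.Face := Quotient.mk (Equiv.Perm.SameCycle.setoid R.facePerm) d

/-- The length of a face: the number of darts on its boundary walk. -/
noncomputable def faceLength (f : R.Face) : ℕ := Nat.card {d : G.Dart // R.face d = f}

theorem face_rot (d : G.Dart) : R.face (R.rot d) = R.face d.symm := by
  apply Quotient.sound
  change R.facePerm.SameCycle (R.rot d) d.symm
  refine Equiv.Perm.SameCycle.symm ⟨1, ?_⟩
  simp [facePerm]

/-- A combinatorial embedding of a (connected) graph is plane if the surface is the sphere, i.e.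
if its Euler characteristic is 2. -/
def IsPlane : Prop :=
  (Nat.card V : ℤ) - Nat.card G.edgeSet + Nat.card R.Face = 2

/-- A regular 4-coloring of the faces of an embedded cubic graph. Faces that share an edge have
different colors, so that the three faces at a vertex (a triangle of the dual triangulation) have
three different colors; and for every edge `uv`, carried by the dart `d` from `u` to `v`, the face
at `v` that does not lie along this edge (the mirror image, in this edge, of the third face
at `u`) has the fourth color, different from those of the three faces at `u`. -/
structure IsRegularFourColoring (c : R.Face → Fin 4) : Prop where
  proper : ∀ d : G.Dart, c (R.face d) ≠ c (R.face d.symm)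
  mirror : ∀ d : G.Dart,
    c (R.face (R.rot (R.rot d.symm))) ≠ c (R.face d) ∧
    c (R.face (R.rot (R.rot d.symm))) ≠ c (R.face (R.rot d)) ∧
    c (R.face (R.rot (R.rot d.symm))) ≠ c (R.face (R.rot (R.rot d)))

end RotationSystem

/-- A (3,6)-fullerene, given with its plane embedding: a cubic polyhedral graph (that is, a
3-connected plane graph) whose non-hexagonal faces are all triangles. -/
structure IsThreeSixFullerene [Fintype V] (G : SimpleGraph V) [DecidableRel G.Adj]
    (R : RotationSystem G) : Prop where
  cubic : G.IsRegularOfDegree 3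
  threeConnected : IsThreeConnected G
  plane : R.IsPlane
  faces : ∀ f : R.Face, R.faceLength f ≠ 6 → R.faceLength f = 3

end Fullerene

namespace Fullerene

/-! ### Vanishing of the first cohomology of the sphere, by rank counting. -/

open Finset Module

/-! Number the darts mod 3 in cyclic order around each vertex. The mismatch of the labels across
edges is a 1-cochain whose sum around a face is the face length, which is 0 mod 3; on a sphere it is
therefore a coboundary. Shifting the labels at each vertex by the potential gives an edge 3-coloring
with the same cyclic order at every vertex (`exists_cyclic_edge_coloring`). Now send the three edge
colors to the three nonzero elements of (Z/2)². These sum to zero around each vertex, so dually they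
are the differences of a function on the faces, which is the coloring: the four faces around an edge
differ from one of them by all four elements of (Z/2)². Both steps rest on `exists_potential`,
applied to the map and to its dual. -/

/-- A linear map on `ι → K` whose kernel consists of constant functions has rank at least
`card ι - 1`. -/
theorem card_le_finrank_range_add_one {K ι M : Type*} [Field K] [Fintype ι] [AddCommGroup M]
    [Module K M] (T : (ι → K) →ₗ[K] M) (hT : ∀ h, T h = 0 → ∀ i j, h i = h j) :
    Fintype.card ι ≤ finrank K (LinearMap.range T) + 1 := by
  have hker : finrank K (LinearMap.ker T) ≤ 1 := by
    have hle : LinearMap.ker T ≤ Submodule.span K {fun _ : ι => (1 : K)} := by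
      intro h hh
      rw [Submodule.mem_span_singleton]
      rcases isEmpty_or_nonempty ι with hι | ⟨⟨i⟩⟩
      · exact ⟨0, Subsingleton.elim _ _⟩
      · refine ⟨h i, funext fun j => ?_⟩
        simpa using hT h hh i j
    exact (Submodule.finrank_mono hle).trans (by simpa using finrank_span_le_card (R := K) ({fun _ : ι => (1 : K)} : Set (ι → K)))
  have := T.finrank_range_add_finrank_ker
  rw [finrank_fintype_fun_eq_card] at this
  omega

/-- The antisymmetric functions on darts, i.e. the 1-cochains. -/
def cochains (K : Type*) [Field K] {D : Type*} (α : D → D) : Submodule K (D → K) where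
  carrier := {w | ∀ d, w (α d) = -w d}
  add_mem' := by
    intro a b ha hb d
    simp only [Pi.add_apply, ha d, hb d]
    ring
  zero_mem' := by intro d; simp
  smul_mem' := by
    intro c a ha d
    simp only [Pi.smul_apply, ha d, smul_neg]

/-- An antisymmetric function is determined by its values on one chosen dart of each edge. -/
theorem finrank_cochains_le {K D E : Type*} [Field K] [Fintype D] [Fintype E] (α : D → D)
    (e : D → E) (he : Function.Surjective e)
    (hα : ∀ d d', e d = e d' → d = d' ∨ d = α d') :
    finrank K (cochains K α) ≤ Fintype.card E := by
  obtain ⟨r, hr⟩ := he.hasRightInverse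
  let T : cochains K α →ₗ[K] (E → K) := (LinearMap.funLeft K K r).comp (cochains K α).subtype
  have hT : Function.Injective T := by
    rw [← LinearMap.ker_eq_bot, LinearMap.ker_eq_bot']
    intro w hw
    have h0 : ∀ x, (w : D → K) (r x) = 0 := fun x => congrFun hw x
    ext d
    rcases hα d (r (e d)) (hr (e d)).symm with h | h
    · rw [h]; exact h0 _
    · rw [h, w.2, h0]; simp
  simpa using LinearMap.finrank_le_finrank_of_injective hT

/-- Vanishing of the first cohomology of a combinatorial sphere: `s d` is the start of the
dart `d`, `f d` the face to its left, `α d` its reversal and `e d` the edge that carries it. -/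
theorem exists_potential {K D N F E : Type*} [Field K] [Fintype D] [Fintype N] [Fintype F]
    [Fintype E] [DecidableEq F] (α : D → D) (hα : Function.Involutive α) (s : D → N) (f : D → F)
    (e : D → E) (he : Function.Surjective e) (hαe : ∀ d d', e d = e d' → d = d' ∨ d = α d')
    (next : Equiv.Perm D) (hs : ∀ d, s (next d) = s (α d)) (hf : ∀ d, f (next d) = f d)
    (hconn : ∀ h : N → K, (∀ d, h (s (α d)) = h (s d)) → ∀ i j, h i = h j)
    (hdual : ∀ g : F → K, (∀ d, g (f (α d)) = g (f d)) → ∀ i j, g i = g j)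
    (hEuler : Fintype.card N + Fintype.card F = Fintype.card E + 2)
    (w : D → K) (hw : ∀ d, w (α d) = -w d) (hclosed : ∀ x, ∑ d with f d = x, w d = 0) :
    ∃ h : N → K, ∀ d, w d = h (s (α d)) - h (s d) := by
  classical
  let T : (N → K) →ₗ[K] (D → K) := LinearMap.funLeft K K (s ∘ α) - LinearMap.funLeft K K s
  have hTapp : ∀ h d, T h d = h (s (α d)) - h (s d) := fun h d => rfl
  have hTrank : Fintype.card N ≤ finrank K (LinearMap.range T) + 1 :=
    card_le_finrank_range_add_one T fun h hh => hconn h fun d => by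
      have := congrFun hh d
      rw [hTapp] at this
      exact sub_eq_zero.mp this
  let S : (D → K) →ₗ[K] (F → K) :=
    LinearMap.pi fun x => ∑ d with f d = x, LinearMap.proj d
  have hSapp : ∀ u x, S u x = ∑ d with f d = x, u d := by
    intro u x
    simp [S]
  let S' : cochains K α →ₗ[K] (F → K) := S.comp (cochains K α).subtype
  have hSrank : Fintype.card F ≤ finrank K (LinearMap.range S') + 1 := by
    let M : Matrix D F K :=
      Matrix.of fun d x => (if f d = x then 1 else 0) - (if f (α d) = x then 1 else 0)
    have hMapp : ∀ g d, M.mulVec g d = g (f d) - g (f (α d)) := by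
      intro g d
      simp [M, Matrix.mulVec, dotProduct, sub_mul, Finset.sum_sub_distrib]
    have h1 : Fintype.card F ≤ M.rank + 1 :=
      card_le_finrank_range_add_one M.mulVecLin fun g hg => hdual g fun d => by
        have := congrFun hg d
        rw [Matrix.mulVecLin_apply, hMapp] at this
        exact (sub_eq_zero.mp this).symm
    rw [← Matrix.rank_transpose] at h1
    -- The transpose sends `u` to `S (u - u ∘ α)`. Antisymmetrizing without dividing by 2 keeps
    -- characteristic 2 allowed.
    have h2 : LinearMap.range M.transpose.mulVecLin ≤ LinearMap.range S' := by
      rintro _ ⟨u, rfl⟩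
      refine ⟨⟨fun d => u d - u (α d), fun d => ?_⟩, ?_⟩
      · simp only [hα d]; ring
      · funext x
        change S (fun d => u d - u (α d)) x = _
        have hinv : ∑ d, (if f (α d) = x then u d else 0)
            = ∑ d, (if f d = x then u (α d) else 0) := by
          refine Fintype.sum_equiv hα.toPerm _ _ fun d => ?_
          simp [hα d]
        rw [hSapp, Finset.sum_sub_distrib, Matrix.mulVecLin_apply]
        simp only [M, Matrix.mulVec, dotProduct, Matrix.transpose_apply, Matrix.of_apply, sub_mul, ite_mul,
          one_mul, zero_mul, Finset.sum_sub_distrib, hinv]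
        simp only [Finset.sum_filter]
    have h3 := Submodule.finrank_mono h2
    change Fintype.card F ≤ finrank K (LinearMap.range M.transpose.mulVecLin) + 1 at h1
    omega
  have hle : LinearMap.range T ≤ (LinearMap.ker S').map (cochains K α).subtype := by
    rintro _ ⟨h, rfl⟩
    refine ⟨⟨T h, fun d => ?_⟩, ?_, rfl⟩
    · simp only [hTapp, hα d]; ring
    · change S (T h) = 0
      funext x
      rw [hSapp]
      simp only [hTapp, Finset.sum_sub_distrib, Pi.zero_apply, ← hs]
      rw [sub_eq_zero, Finset.sum_filter, Finset.sum_filter]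
      refine Fintype.sum_equiv next _ _ fun d => ?_
      simp [hf]
  have hker := S'.finrank_range_add_finrank_ker
  have hE := finrank_cochains_le (K := K) α e he hαe
  have hmap : finrank K ((LinearMap.ker S').map (cochains K α).subtype)
      = finrank K (LinearMap.ker S') :=
    Submodule.finrank_map_subtype_eq _ _
  -- By Euler, dim `ker S'` ≤ |E| - (|F| - 1) = |N| - 1 ≤ rank `T`.
  have heq := Submodule.eq_of_le_of_finrank_le hle (by omega)
  have hmem : w ∈ LinearMap.range T := by
    rw [heq]
    refine ⟨⟨w, hw⟩, ?_, rfl⟩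
    change S w = 0
    funext x
    rw [hSapp]
    exact hclosed x
  obtain ⟨h, rfl⟩ := hmem
  exact ⟨h, fun d => rfl⟩

/-! ### Rotations of cubic maps and connectedness of the dual. -/

namespace RotationSystem

variable {G : SimpleGraph V} (R : RotationSystem G)

theorem facePerm_apply (d : G.Dart) : R.facePerm d = R.rot d.symm := rfl

theorem fst_rot (d : G.Dart) : (R.rot d).fst = d.fst :=
  ((R.sameCycle_iff d (R.rot d)).mp ⟨1, by simp⟩).symm

theorem face_facePerm (d : G.Dart) : R.face (R.facePerm d) = R.face d := by
  rw [facePerm_apply, face_rot, SimpleGraph.Dart.symm_symm]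

theorem fst_facePerm (d : G.Dart) : (R.facePerm d).fst = d.symm.fst := by
  rw [facePerm_apply, fst_rot]

theorem face_surjective : Function.Surjective R.face := Quotient.mk_surjective

instance [Finite G.Dart] : Finite R.Face := Finite.of_surjective _ R.face_surjective

/-- In a cubic graph, `rot` has order three at each dart. -/
theorem rot_zpow_apply_eq_self_iff [Fintype V] [DecidableRel G.Adj]
    (hG : G.IsRegularOfDegree 3) (d : G.Dart) (m : ℤ) : (R.rot ^ m) d = d ↔ (3 : ℤ) ∣ m := by
  classical
  have hp : Function.minimalPeriod (R.rot • ·) d = 3 := by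
    rw [MulAction.minimalPeriod_eq_card, ← Nat.card_eq_fintype_card,
      ← hG d.fst, ← G.dart_fst_fiber_card_eq_degree, Nat.card_coe_set_eq,
      ← Set.ncard_coe_finset]
    congr 1
    ext x
    simp only [Finset.coe_filter, Finset.mem_univ, true_and, Set.mem_ofPred_eq]
    rw [eq_comm, ← R.sameCycle_iff, MulAction.mem_orbit_iff]
    constructor
    · rintro ⟨⟨_, k, rfl⟩, hk⟩
      exact ⟨k, hk⟩
    · rintro ⟨k, hk⟩
      exact ⟨⟨_, k, rfl⟩, hk⟩
  have := MulAction.zpow_smul_eq_iff_minimalPeriod_dvd (a := R.rot) (b := d) (n := m)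
  rw [hp] at this
  exact this

/-- The darts of a cubic map can be numbered modulo 3 in cyclic order around each vertex. -/
theorem exists_cyclic_labelling [Fintype V] [DecidableRel G.Adj] (hG : G.IsRegularOfDegree 3) :
    ∃ l : G.Dart → ZMod 3, ∀ d, l (R.rot d) = l d + 1 := by
  let St : Setoid G.Dart := Equiv.Perm.SameCycle.setoid R.rot
  have hb : ∀ d : G.Dart, ∃ k : ℤ, (R.rot ^ k) (Quotient.mk St d).out = d :=
    fun d => Quotient.mk_out (s := St) d
  choose k hk using hb
  refine ⟨fun d => (k d : ZMod 3), fun d => ?_⟩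
  have hq : Quotient.mk St (R.rot d) = Quotient.mk St d :=
    Quotient.sound (s := St) (Equiv.Perm.SameCycle.symm ⟨1, by simp⟩)
  have h1 := hk (R.rot d)
  rw [hq] at h1
  have h2 : (R.rot ^ (k (R.rot d) - (k d + 1))) (Quotient.mk St d).out
      = (Quotient.mk St d).out := by
    rw [sub_eq_neg_add, zpow_add, Equiv.Perm.mul_apply, h1, zpow_neg, Equiv.Perm.inv_eq_iff_eq,
      add_comm, zpow_add, Equiv.Perm.mul_apply, hk d, zpow_one]
  rw [R.rot_zpow_apply_eq_self_iff hG] at h2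
  have h3 := (ZMod.intCast_eq_intCast_iff_dvd_sub (k d + 1) (k (R.rot d)) 3).mpr h2
  push_cast at h3
  exact h3.symm

theorem eq_of_forall_adj {K : Type*} (hG : G.Connected) (h : V → K)
    (hh : ∀ d : G.Dart, h d.symm.fst = h d.fst) (i j : V) : h i = h j := by
  obtain ⟨p⟩ := hG.preconnected i j
  induction p with
  | nil => rfl
  | cons hadj _ ih => exact (hh ⟨(_, _), hadj⟩).symm.trans ih

theorem eq_of_fst_eq {K : Type*} (u : G.Dart → K) (hu : ∀ d, u (R.rot d) = u d) {d d' : G.Dart}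
    (h : d.fst = d'.fst) : u d = u d' := by
  obtain ⟨k, rfl⟩ := (R.sameCycle_iff d d').mpr h
  clear h
  induction k with
  | zero => simp
  | succ n ih => rw [ih, add_comm, zpow_add, Equiv.Perm.mul_apply, zpow_one, hu]
  | pred n ih =>
    rw [ih, ← hu ((R.rot ^ (-(n : ℤ) - 1)) d), sub_eq_neg_add, zpow_add, Equiv.Perm.mul_apply]
    simp

/-- The dual is connected: consecutive faces around a vertex share an edge, and both ends of an edge
meet the same face along it, so `g` propagates along a walk in `G`. -/
theorem eq_of_forall_face {K : Type*} (hG : G.Connected) (g : R.Face → K)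
    (hg : ∀ d, g (R.face d.symm) = g (R.face d)) (x y : R.Face) : g x = g y := by
  obtain ⟨d, rfl⟩ := R.face_surjective x
  obtain ⟨d', rfl⟩ := R.face_surjective y
  have hu : ∀ {d d' : G.Dart}, d.fst = d'.fst → g (R.face d) = g (R.face d') :=
    R.eq_of_fst_eq (fun d => g (R.face d)) fun d => by rw [face_rot, hg]
  obtain ⟨p⟩ := hG.preconnected d.fst d'.fst
  have key : ∀ {v w : V} (_ : G.Walk v w) (d d' : G.Dart), d.fst = v → d'.fst = w →
      g (R.face d) = g (R.face d') := by
    intro v w p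
    induction p with
    | nil => exact fun d d' h h' => hu (h.trans h'.symm)
    | @cons v x w hadj _ ih =>
      intro d d' h h'
      let e : G.Dart := ⟨(v, x), hadj⟩
      have h1 : g (R.face d) = g (R.face e) := hu h
      rw [h1, ← hg e]
      exact ih e.symm d' rfl h'
  exact key p d d' rfl rfl

theorem edge_surjective :
    Function.Surjective fun d : G.Dart => (⟨d.edge, d.edge_mem⟩ : G.edgeSet) := by
  rintro ⟨e, he⟩
  induction e using Sym2.ind with
  | _ a b => exact ⟨⟨(a, b), he⟩, rfl⟩

/-! ### Potentials on plane maps and the cyclic edge coloring. -/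

variable [Fintype V]

theorem IsPlane.card_add_card {R : RotationSystem G} (hR : R.IsPlane) [Fintype R.Face]
    [Fintype G.edgeSet] :
    Fintype.card V + Fintype.card R.Face = Fintype.card G.edgeSet + 2 := by
  have h : (Nat.card V : ℤ) - Nat.card G.edgeSet + Nat.card R.Face = 2 := hR
  simp only [Nat.card_eq_fintype_card] at h
  omega

/-- On a connected plane map, a vertex potential exists for every 1-cochain whose sum around each
face vanishes. -/
theorem exists_vertex_potential (hG : G.Connected) (hR : R.IsPlane) {K : Type*} [Field K]
    [Fintype G.Dart] [DecidableEq R.Face] (w : G.Dart → K) (hw : ∀ d, w d.symm = -w d)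
    (hclosed : ∀ x, ∑ d with R.face d = x, w d = 0) :
    ∃ h : V → K, ∀ d : G.Dart, w d = h d.symm.fst - h d.fst := by
  have := Fintype.ofFinite R.Face
  have := Fintype.ofFinite G.edgeSet
  exact exists_potential SimpleGraph.Dart.symm SimpleGraph.Dart.symm_involutive
    (fun d : G.Dart => d.fst) R.face _ edge_surjective
    (fun d d' h => (SimpleGraph.dart_edge_eq_iff d d').mp (congrArg Subtype.val h))
    R.facePerm R.fst_facePerm R.face_facePerm (eq_of_forall_adj hG) (R.eq_of_forall_face hG)
    hR.card_add_card w hw hclosed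

/-- On a connected plane map, a face potential exists for every 1-cochain whose sum around each
vertex vanishes. -/
theorem exists_face_potential (hG : G.Connected) (hR : R.IsPlane) {K : Type*} [Field K]
    [Fintype G.Dart] [DecidableEq V] (w : G.Dart → K) (hw : ∀ d, w d.symm = -w d)
    (hclosed : ∀ v, ∑ d : G.Dart with d.fst = v, w d = 0) :
    ∃ h : R.Face → K, ∀ d : G.Dart, w d = h (R.face d.symm) - h (R.face d) := by
  have := Fintype.ofFinite R.Face
  have := Fintype.ofFinite G.edgeSet
  exact exists_potential SimpleGraph.Dart.symm SimpleGraph.Dart.symm_involutive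
    R.face (fun d : G.Dart => d.fst) _ edge_surjective
    (fun d d' h => (SimpleGraph.dart_edge_eq_iff d d').mp (congrArg Subtype.val h))
    R.rot R.face_rot R.fst_rot (R.eq_of_forall_face hG) (eq_of_forall_adj hG)
    ((add_comm _ _).trans hR.card_add_card) w hw hclosed

/-- The edges of a (3,6)-fullerene have a 3-coloring in which the colors appear in the same cyclic
order around every vertex. -/
theorem exists_cyclic_edge_coloring [DecidableRel G.Adj] (hR : IsThreeSixFullerene G R)
    (hG : G.Connected) :
    ∃ p : G.Dart → ZMod 3, (∀ d, p (R.rot d) = p d + 1) ∧ ∀ d, p d.symm = p d := by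
  classical
  obtain ⟨l, hl⟩ := R.exists_cyclic_labelling hR.cubic
  obtain ⟨h, hh⟩ := R.exists_vertex_potential hG hR.plane (fun d => l d - l d.symm)
    (fun d => by simp only [SimpleGraph.Dart.symm_symm]; ring) fun x => by
      -- Around a face the differences cancel and each dart contributes 1, leaving the face length.
      have hsub : ∀ d : G.Dart, l d - l d.symm = l d - l (R.facePerm d) + 1 := fun d => by
        rw [facePerm_apply, hl]; ring
      have hinv : ∑ d with R.face d = x, l (R.facePerm d) = ∑ d with R.face d = x, l d := by
        rw [Finset.sum_filter, Finset.sum_filter]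
        refine Fintype.sum_equiv R.facePerm _ _ fun d => ?_
        simp [face_facePerm]
      have hcard : #{d | R.face d = x} = R.faceLength x := by
        rw [faceLength, Nat.card_eq_fintype_card, Fintype.card_subtype]
      simp only [hsub, Finset.sum_add_distrib, Finset.sum_sub_distrib, hinv, sub_self, zero_add,
        Finset.sum_const, nsmul_eq_mul, mul_one, hcard]
      by_cases h6 : R.faceLength x = 6
      · rw [h6]; rfl
      · rw [hR.faces x h6]; rfl
  refine ⟨fun d => l d + h d.fst, fun d => ?_, fun d => ?_⟩
  · simp only [hl, fst_rot]; ring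
  · linear_combination -hh d

/-- A function of the colors of an edge coloring as above is the coboundary of a function on the
faces if its values on the three colors sum to zero. -/
theorem exists_face_potential_of_edge_coloring (hG : G.Connected) (hR : R.IsPlane)
    (p : G.Dart → ZMod 3) (hrot : ∀ d, p (R.rot d) = p d + 1) (hsymm : ∀ d, p d.symm = p d)
    (a : ZMod 3 → ZMod 2) (ha : ∀ x, a x + a (x + 1) + a (x + 1 + 1) = 0) :
    ∃ h : R.Face → ZMod 2, ∀ d, h (R.face d.symm) = h (R.face d) + a (p d) := by
  classical
  have := Fintype.ofFinite G.Dart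
  have hshift : ∀ (v : V) (u : G.Dart → ZMod 2),
      ∑ d : G.Dart with d.fst = v, u (R.rot d) = ∑ d : G.Dart with d.fst = v, u d := by
    intro v u
    rw [Finset.sum_filter, Finset.sum_filter]
    refine Fintype.sum_equiv R.rot _ _ fun d => ?_
    simp [fst_rot]
  obtain ⟨h, hh⟩ := R.exists_face_potential hG hR (fun d => a (p d))
    (fun d => by simp only [hsymm, ZModModule.neg_eq_self]) fun v => by
      have h1 := hshift v fun d => a (p d)
      have h2 := hshift v fun d => a (p (R.rot d))
      -- By `ha` every summand vanishes; by rotation invariance the total is three times the wanted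
      -- sum, which equals that sum mod 2.
      have h3 : ∑ d : G.Dart with d.fst = v,
          (a (p d) + a (p (R.rot d)) + a (p (R.rot (R.rot d)))) = 0 :=
        Finset.sum_eq_zero fun d _ => by rw [hrot (R.rot d), hrot d, ha]
      rw [Finset.sum_add_distrib, Finset.sum_add_distrib, h2, h1, CharTwo.add_self_eq_zero,
        zero_add] at h3
      exact h3
  exact ⟨h, fun d => by linear_combination -hh d⟩

end RotationSystem

theorem IsThreeConnected.connected {G : SimpleGraph V} (hG : IsThreeConnected G) :
    G.Connected := by
  have h := hG.2 ∅ Set.finite_empty (by simp)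
  rw [Set.compl_empty] at h
  exact (SimpleGraph.induceUnivIso G).connected_iff.mp h

end Fullerene

/-! ### The regular 4-coloring. -/

theorem corollary2 {V : Type*} [Fintype V] (G : SimpleGraph V) [DecidableRel G.Adj]
    (R : Fullerene.RotationSystem G) (hR : Fullerene.IsThreeSixFullerene G R) :
    ∃ c : R.Face → Fin 4, R.IsRegularFourColoring c := by
  have hG := hR.threeConnected.connected
  obtain ⟨p, hrot, hsymm⟩ := R.exists_cyclic_edge_coloring hR hG
  -- The pairs `(a x, b x)` for x = 0, 1, 2 are (0,1), (1,0), (1,1).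
  let a : ZMod 3 → ZMod 2 := fun x => if x = 0 then 0 else 1
  let b : ZMod 3 → ZMod 2 := fun x => if x = 1 then 0 else 1
  obtain ⟨h, hh⟩ := R.exists_face_potential_of_edge_coloring hG hR.plane p hrot hsymm a (by decide)
  obtain ⟨k, hk⟩ := R.exists_face_potential_of_edge_coloring hG hR.plane p hrot hsymm b (by decide)
  let E : ZMod 2 × ZMod 2 ≃ Fin 4 := finProdFinEquiv
  have hrotrot : ∀ d : G.Dart, R.face (R.rot (R.rot d.symm)) = R.face (R.rot d.symm).symm :=
    fun d => R.face_rot _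
  have hface : ∀ d : G.Dart, R.face (R.rot d.symm) = R.face d := fun d => R.face_facePerm d
  have hne : ∀ x, a x = 0 → b x ≠ 0 := by decide
  have hne' : ∀ x, a x = a (x + 1) → b x ≠ b (x + 1) := by decide
  refine ⟨fun x => E (h x, k x), fun d heq => ?_, fun d => ⟨fun heq => ?_, fun heq => ?_,
    fun heq => ?_⟩⟩ <;>
    obtain ⟨h1, h2⟩ := Prod.mk.inj (E.injective heq)
  · rw [hh] at h1
    rw [hk] at h2
    exact hne (p d) (by simpa using h1) (by simpa using h2)
  -- The mirror face is reached from `R.face d` by crossing an edge of color `p d + 1`.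
  · rw [hrotrot, hh, hface, hrot, hsymm] at h1
    rw [hrotrot, hk, hface, hrot, hsymm] at h2
    exact hne (p d + 1) (by simpa using h1) (by simpa using h2)
  · rw [hrotrot, hh, hface, hrot, hsymm, R.face_rot, hh] at h1
    rw [hrotrot, hk, hface, hrot, hsymm, R.face_rot, hk] at h2
    exact hne' (p d) (add_left_cancel h1).symm (add_left_cancel h2).symm
  -- The third face at `u` is reached by crossing colors `p d` and `p d + 1`, so it differs from the
  -- mirror face by the nonzero element of color `p d`.
  · rw [hrotrot, hh, hface, hrot, hsymm, R.face_rot, hh, hrot, R.face_rot, hh] at h1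
    rw [hrotrot, hk, hface, hrot, hsymm, R.face_rot, hk, hrot, R.face_rot, hk] at h2
    exact hne (p d) (by linear_combination -h1) (by linear_combination -h2)
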